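/- In the (deterministic) LOCAL model, a graph with $n$ nodes and maximum degree $\Delta$ is given, every node has a unique identifier from $\{1,\dots,n^c\}$ for a constant $c$ and initially knows $n$, $\Delta$, its identifier and its degree. Computation proceeds in synchronous rounds; in each round every node sends a (possibly different) message of arbitrary size to each of its neighbors, receives the messages of its neighbors, and performs an arbitrary deterministic local computation. Maximal matching can be solved deterministically in $O(\log n/\log\log n)$ rounds on trees. That is, for every constant $c$ there are a deterministic LOCAL algorithm $\mathcal A$ and a function $T:\mathbb N\to\mathbb N$ with $T(n)=O(\log n/\log\log n)$ as $n\to\infty$ (the hidden constant may depend on $c$) such that for every $n$, every tree with $n$ nodes, every assignment of unique identifiers from $\{1,\dots,n^c\}$ and every numbering of the edges incident to each node, running $\mathcal A$ for $T(n)$ rounds produces a maximal matching $M$, i.e. an inclusion-maximal set of pairwise disjoint edges: after these rounds each node outputs, for each of its incident edges, whether the edge belongs to $M$. -/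

import Mathlib

namespace LocalModel

/-- An instance of the LOCAL model on the finite node set `V`: an undirected simple graph, globally
unique identifiers from `{1, …, n ^ c}` where `n` is the number of nodes, and for every node an
(arbitrary) enumeration of its neighbors, by which the node tells its incident edges apart. -/
structure Network (V : Type*) [Fintype V] (c : ℕ) where
  graph : SimpleGraph V
  ident : V → ℕ
  ident_injective : Function.Injective ident
  one_le_ident : ∀ v, 1 ≤ ident v
  ident_le : ∀ v, ident v ≤ Fintype.card V ^ c
  nbrs : V → List V
  nbrs_nodup : ∀ v, (nbrs v).Nodup
  mem_nbrs : ∀ v u, u ∈ nbrs v ↔ graph.Adj v u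

open Classical in
/-- The port of `v` leading to its neighbor `u`: the position of `u` in the enumeration of the
neighbors of `v`. -/
noncomputable def Network.port {V : Type*} [Fintype V] {c : ℕ} (N : Network V c) (v u : V) : ℕ :=
  (N.nbrs v).idxOf u

/-- A deterministic LOCAL algorithm that labels half-edges by elements of `α`; message size and
local computation are unrestricted. -/
structure Algorithm (α : Type) where
  State : Type
  Msg : Type
  /-- the initial state, from the number of nodes `n`, the maximum degree `Δ`, and the node's own
  identifier and degree -/
  init : (n Δ ident deg : ℕ) → State
  /-- the message sent through each port -/
  send : State → (port : ℕ) → Msg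
  /-- the new state, from the current one and the received messages, listed by port -/
  receive : State → List Msg → State
  /-- the final label of the half-edge at each port -/
  output : State → (port : ℕ) → α

open Classical in
/-- The state of each node after `t` synchronous rounds. -/
noncomputable def Algorithm.state {α : Type} (A : Algorithm α) {V : Type*} [Fintype V] {c : ℕ}
    (N : Network V c) : ℕ → V → A.State
  | 0, v => A.init (Fintype.card V) N.graph.maxDegree (N.ident v) (N.nbrs v).length
  | t + 1, v => A.receive (A.state N t v)
      ((N.nbrs v).map fun u => A.send (A.state N t u) (N.port u v))

/-- The label that `v` outputs, after `t` rounds, on the half-edge at `v` of the edge `{v, u}`. -/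
noncomputable def Algorithm.halfEdgeOutput {α : Type} (A : Algorithm α) {V : Type*} [Fintype V]
    {c : ℕ} (N : Network V c) (t : ℕ) (v u : V) : α :=
  A.output (A.state N t v) (N.port v u)

/-- A maximal matching of `G`: a matching that is not properly contained in another matching. -/
def IsMaximalMatching {V : Type*} {G : SimpleGraph V} (M : G.Subgraph) : Prop :=
  Maximal (fun M' : G.Subgraph => M'.IsMatching) M

/-- Running `A` for `t` rounds on `N` yields a maximal matching: both endpoints of every edge output
on their half-edge whether the edge is matched. -/
def Algorithm.ComputesMaximalMatching (A : Algorithm Bool) {V : Type*} [Fintype V] {c : ℕ}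
    (N : Network V c) (t : ℕ) : Prop :=
  ∃ M : N.graph.Subgraph, IsMaximalMatching M ∧
    ∀ v u, N.graph.Adj v u → (A.halfEdgeOutput N t v u = true ↔ M.Adj v u)

end LocalModel

/-! Degrees in a forest average at most 2, so few vertices have many neighbors. Put s = `shrink n`,
about sqrt(log n). Repeatedly peel off the nodes with at most 2s remaining neighbors, orienting
their edges towards those neighbors. The remaining set shrinks by a factor s per round
(`card_outs_eq_none`), so O(log n / log s) rounds exhaust it; every edge is then oriented in at
least one direction, and out-degrees are at most 2s.

The i-th out-edges form a graph with at most one parent per node. Two Cole–Vishkin steps, run in all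
these graphs in parallel, color each of them properly with O(log log n) colors. Then, for each graph
and each color in turn, every unmatched node of that color proposes to one unmatched child. The
child has another color, hence is not proposing itself, and has no second parent in this graph, so
every proposal is accepted (`IsMutual.propose_accept`). Once the color of the parent of an edge has
had its turn, the parent or the child is matched (`mate_ne_none_of_adj`), which gives maximality.

The matching phase costs O(s log log n) rounds. The square root makes log s of order log log n while
keeping this cost within O(log n / log log n). -/

open Filter

/-! ### Degree counting in forests -/

namespace SimpleGraph

/-- The degrees of a finite forest sum to at most twice the number of its vertices. -/
theorem IsAcyclic.sum_degree_le {W : Type*} [Fintype W] {H : SimpleGraph W}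
    [DecidableRel H.Adj] (h : H.IsAcyclic) : ∑ v, H.degree v ≤ 2 * Fintype.card W := by
  classical
  rw [H.sum_degrees_eq_twice_card_edges]
  rcases isEmpty_or_nonempty W with hW | hW
  · have : H = ⊥ := Subsingleton.elim _ _
    subst this
    simp
  -- Extend the forest to a spanning tree of the complete graph, whose number of edges is known.
  · obtain ⟨F, hle, -, hF⟩ :=
      (connected_top (V := W)).exists_isTree_le_of_le_of_isAcyclic le_top h
    have h1 := hF.card_edgeFinset
    have h2 : H.edgeFinset.card ≤ F.edgeFinset.card :=
      Finset.card_le_card (edgeFinset_mono hle)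
    omega

/-- In a forest, at most a `2 / (d + 1)` fraction of the vertices of a set `S` have more than `d`
neighbors in `S`. -/
theorem IsAcyclic.card_filter_lt_card_inter {V : Type*} [Fintype V] [DecidableEq V]
    {G : SimpleGraph V} [DecidableRel G.Adj] (h : G.IsAcyclic) (S : Finset V) (d : ℕ) :
    (d + 1) * (S.filter fun v => d < (G.neighborFinset v ∩ S).card).card ≤ 2 * S.card := by
  -- The subgraph induced on `S` is again a forest; each vertex counted adds at least `d + 1` to its
  -- degree sum.
  have h1 := (h.induce (S : Set V)).sum_degree_le
  have h2 : ∀ v : (S : Set V), (G.induce (S : Set V)).degree v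
      = (G.neighborFinset (v : V) ∩ S).card := by
    intro v
    rw [← card_neighborFinset_eq_degree, ← Finset.card_map (Function.Embedding.subtype _)]
    congr 1
    ext w
    simp [and_comm]
  have h3 : ∑ v : (S : Set V), (G.induce (S : Set V)).degree v
      = ∑ v ∈ S, (G.neighborFinset v ∩ S).card := by
    rw [Finset.sum_congr rfl fun v _ => h2 v]
    exact Finset.sum_coe_sort S fun v => (G.neighborFinset v ∩ S).card
  rw [h3] at h1
  have h4 : Fintype.card (S : Set V) = S.card := by simp
  rw [h4] at h1
  refine le_trans ?_ h1
  rw [mul_comm, ← smul_eq_mul]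
  refine (Finset.card_nsmul_le_sum _ _ (d + 1) fun v hv => ?_).trans
    (Finset.sum_le_sum_of_subset (Finset.filter_subset _ _))
  exact (Finset.mem_filter.1 hv).2

end SimpleGraph

/-! ### Cole–Vishkin color reduction -/

namespace LocalModel

/-- The Cole–Vishkin color reduction: the position of the lowest bit in which `a` differs from `b`,
together with the value of that bit in `a`. -/
noncomputable def coleVishkin (a b : ℕ) : ℕ :=
  2 * sInf {i | a.testBit i ≠ b.testBit i} + (a.testBit (sInf {i | a.testBit i ≠ b.testBit i})).toNat

theorem testBit_sInf_ne {a b : ℕ} (h : a ≠ b) :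
    a.testBit (sInf {i | a.testBit i ≠ b.testBit i})
      ≠ b.testBit (sInf {i | a.testBit i ≠ b.testBit i}) :=
  Nat.sInf_mem (s := {i | a.testBit i ≠ b.testBit i}) (Nat.exists_testBit_ne_of_ne h)

/-- Equal values would encode the same position with the same bit, but `a` and `b` differ at the
position chosen for `a`. The color `e` is arbitrary, so cycles and parentless nodes do no harm. -/
theorem coleVishkin_ne {a b e : ℕ} (hab : a ≠ b) :
    coleVishkin a b ≠ coleVishkin b e := by
  intro h
  have h1 := testBit_sInf_ne hab
  unfold coleVishkin at h
  generalize sInf {i | a.testBit i ≠ b.testBit i} = i at *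
  generalize sInf {i | b.testBit i ≠ e.testBit i} = j at *
  have hij : i = j := by
    have := Bool.toNat_lt (a.testBit i)
    have := Bool.toNat_lt (b.testBit j)
    omega
  subst hij
  cases ha : a.testBit i <;> cases hb : b.testBit i <;> simp_all

theorem coleVishkin_lt {a b m : ℕ} (hab : a ≠ b) (ha : a < 2 ^ m) (hb : b < 2 ^ m) :
    coleVishkin a b < 2 * m := by
  have h1 := testBit_sInf_ne hab
  unfold coleVishkin
  generalize sInf {i | a.testBit i ≠ b.testBit i} = i at *
  have : i < m := by
    by_contra hi
    have hle : 2 ^ m ≤ 2 ^ i := Nat.pow_le_pow_right (by norm_num) (by omega)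
    rw [Nat.testBit_lt_two_pow (ha.trans_le hle), Nat.testBit_lt_two_pow (hb.trans_le hle)] at h1
    exact h1 rfl
  have := Bool.toNat_lt (a.testBit i)
  omega

/-- A node's color after one Cole–Vishkin step, where `b` is the color of its parent, if any. -/
noncomputable def reduceColor (a : ℕ) (b : Option ℕ) : ℕ :=
  -- A node without parent compares with a fictitious color different from its own and below `2 ^ m`
  -- for every `m > 0`.
  coleVishkin a (b.getD (if a = 0 then 1 else 0))

theorem reduceColor_lt {a m : ℕ} {b : Option ℕ} (hm : 0 < m) (hab : b ≠ some a) (ha : a < 2 ^ m)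
    (hb : ∀ x ∈ b, x < 2 ^ m) : reduceColor a b < 2 * m := by
  refine coleVishkin_lt ?_ ha ?_
  · cases b with
    | none => simp only [Option.getD_none]; split <;> omega
    | some x => simpa using fun h => hab (by rw [h])
  · cases b with
    | none =>
      have := Nat.one_lt_two_pow hm.ne'
      simp only [Option.getD_none]; split <;> omega
    | some x => simpa using hb x rfl

/-! ### Parameters -/

/-- The number of bits of an identifier. -/
def identBits (c n : ℕ) : ℕ := c * (Nat.log 2 n + 1) + 1

/-- The number of colors left after two Cole–Vishkin steps. -/
def numColors (c n : ℕ) : ℕ := 2 * (Nat.log 2 (2 * identBits c n) + 1)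

/-- Each peeling round shrinks the set of remaining nodes by this factor. -/
def shrink (n : ℕ) : ℕ := Nat.sqrt (Nat.log 2 n) + 2

/-- The bound on the number of outgoing edges of a node. -/
def outBound (n : ℕ) : ℕ := 2 * shrink n

/-- The number of peeling rounds. -/
def peelRounds (n : ℕ) : ℕ := Nat.log (shrink n) n + 1

/-- The total number of rounds. -/
def totalRounds (c n : ℕ) : ℕ := peelRounds n + 2 + 2 * (outBound n * numColors c n)

theorem lt_shrink_pow_peelRounds (n : ℕ) : n < shrink n ^ peelRounds n :=
  Nat.lt_pow_succ_log_self (by unfold shrink; omega) n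

theorem pow_lt_two_pow_identBits (c n : ℕ) : n ^ c < 2 ^ identBits c n := by
  calc n ^ c ≤ (2 ^ (Nat.log 2 n + 1)) ^ c :=
        Nat.pow_le_pow_left (Nat.lt_pow_succ_log_self (by norm_num) n).le c
    _ = 2 ^ (c * (Nat.log 2 n + 1)) := by rw [← pow_mul, mul_comm]
    _ < 2 ^ identBits c n := Nat.pow_lt_pow_right (by norm_num) (by unfold identBits; omega)

/-! ### The algorithm -/

/-- The local state of a node in the matching algorithm. -/
structure NodeState where
  n : ℕ
  time : ℕ
  ident : ℕ
  /-- the identifiers of the neighbors, listed by port -/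
  nbrs : List ℕ
  /-- the identifiers of the out-neighbors, once they are determined -/
  outs : Option (List ℕ)
  /-- the color of the node in each of the functional graphs given by `outs` -/
  color : ℕ → ℕ
  /-- the identifier of the node to which this one is matched -/
  mate : Option ℕ

/-- The identifier of the `i`-th out-neighbor. -/
def NodeState.parent (s : NodeState) (i : ℕ) : Option ℕ := s.outs.bind fun l => l[i]?

/-- One peeling step: a node none of whose edges is oriented yet, and which has few such neighbors,
orients its edges towards them. -/
def NodeState.newOuts (s : NodeState) (ms : List NodeState) : Option (List ℕ) :=
  match s.outs with
  | some l => some l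
  | none =>
    if (ms.filter fun m => m.outs.isNone).length ≤ outBound s.n then
      -- Adjacent nodes peeled in the same round list each other, so the functional graphs may
      -- contain 2-cycles.
      some ((ms.filter fun m => m.outs.isNone).map NodeState.ident)
    else none

noncomputable def NodeState.newColor (s : NodeState) (ms : List NodeState) (i : ℕ) : ℕ :=
  reduceColor (s.color i)
    ((ms.find? fun m => s.parent i == some m.ident).map fun m => m.color i)

/-- A node of color `k` proposes to an unmatched child in the `i`-th functional graph. -/
def NodeState.propose (s : NodeState) (ms : List NodeState) (i k : ℕ) : Option ℕ :=
  if s.mate = none ∧ s.color i = k then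
    (ms.find? fun m => m.mate.isNone && m.parent i == some s.ident).map NodeState.ident
  else s.mate

/-- An unmatched node accepts a proposal. -/
def NodeState.accept (s : NodeState) (ms : List NodeState) : Option ℕ :=
  if s.mate = none then (ms.find? fun m => m.mate == some s.ident).map NodeState.ident else s.mate

/-- The matching step in round `r` of the matching phase, with `C` colors. -/
def NodeState.newMate (s : NodeState) (ms : List NodeState) (C r : ℕ) : Option ℕ :=
  if r % 2 = 0 then s.propose ms (r / 2 / C) (r / 2 % C) else s.accept ms

/-- Maximal matching on forests: orient the edges with few outgoing edges per node, color the
resulting functional graphs, and then match each color class of each of them in turn. -/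
noncomputable def matchingAlgorithm (c : ℕ) : Algorithm Bool where
  State := NodeState
  Msg := NodeState
  init n _ ident _ := ⟨n, 0, ident, [], none, fun _ => ident, none⟩
  send s _ := s
  receive s ms :=
    { n := s.n
      time := s.time + 1
      ident := s.ident
      nbrs := ms.map NodeState.ident
      outs := s.newOuts ms
      color := if peelRounds s.n ≤ s.time ∧ s.time < peelRounds s.n + 2 then s.newColor ms
        else s.color
      mate := if peelRounds s.n + 2 ≤ s.time then
          s.newMate ms (numColors c s.n) (s.time - (peelRounds s.n + 2))
        else s.mate }
  output s p := s.mate.isSome && s.nbrs[p]? == s.mate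

/-! ### Proposals and acceptances -/

/-- Each node holds the identifier of a mate, and mates agree with each other. -/
def IsMutual {V : Type*} (G : SimpleGraph V) (ident : V → ℕ) (m : V → Option ℕ) : Prop :=
  ∀ v x, m v = some x → ∃ u, G.Adj v u ∧ ident u = x ∧ m u = some (ident v)

/-- A proposal step followed by an acceptance step keeps mates mutual. -/
theorem IsMutual.propose_accept {V : Type*} {G : SimpleGraph V} {ident : V → ℕ}
    (hinj : Function.Injective ident) {p : V → Option ℕ} {col : V → ℕ} {k : ℕ}
    (hcol : ∀ v u, G.Adj v u → p v = some (ident u) → col v ≠ col u)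
    {m₀ m₁ m₂ : V → Option ℕ} (h₀ : IsMutual G ident m₀)
    (h1 : ∀ v, ¬(m₀ v = none ∧ col v = k) → m₁ v = m₀ v)
    (h2 : ∀ v, m₀ v = none → col v = k → ∀ x, m₁ v = some x →
      ∃ u, G.Adj v u ∧ ident u = x ∧ m₀ u = none ∧ p u = some (ident v))
    (h3 : ∀ v, m₁ v ≠ none → m₂ v = m₁ v)
    (h4 : ∀ v, m₁ v = none → ∀ x, m₂ v = some x →
      ∃ u, G.Adj v u ∧ ident u = x ∧ m₁ u = some (ident v))
    (h5 : ∀ v, m₁ v = none → m₂ v = none → ∀ u, G.Adj v u → m₁ u ≠ some (ident v)) :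
    IsMutual G ident m₂ := by
  intro v x hx
  by_cases hv1 : m₁ v = none
  · obtain ⟨u, hu, rfl, hum⟩ := h4 v hv1 x hx
    exact ⟨u, hu, rfl, by rw [h3 u (by simp [hum]), hum]⟩
  rw [h3 v hv1] at hx
  by_cases hv0 : m₀ v = none ∧ col v = k
  swap
  · rw [h1 v hv0] at hx
    obtain ⟨u, hu, rfl, hum⟩ := h₀ v x hx
    have hu1 : m₁ u = some (ident v) := by rw [h1 u (by simp [hum]), hum]
    exact ⟨u, hu, rfl, by rw [h3 u (by simp [hu1]), hu1]⟩
  obtain ⟨u, hu, rfl, hu0, hpu⟩ := h2 v hv0.1 hv0.2 x hx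
  refine ⟨u, hu, rfl, ?_⟩
  -- The child `u` is colored differently from its parent `v`, so it did not propose.
  have hu1 : m₁ u = none := by
    rw [h1 u fun h => hcol u v hu.symm hpu (h.2.trans hv0.2.symm), hu0]
  -- Having an offer from `v`, the node `u` accepts some offer, say from `w`. If `w` proposed in
  -- this step, it is the unique parent of `u`, that is, `v`; otherwise `w` was already the mate of
  -- `u`, which was unmatched.
  cases hu2 : m₂ u with
  | none => exact absurd hx (h5 u hu1 hu2 v hu.symm)
  | some y =>
    obtain ⟨w, hw, rfl, hwm⟩ := h4 u hu1 y hu2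
    by_cases hw0 : m₀ w = none ∧ col w = k
    · obtain ⟨u', -, hid, -, hp⟩ := h2 w hw0.1 hw0.2 _ hwm
      rw [hinj hid, hpu] at hp
      exact hp.symm
    · rw [h1 w hw0] at hwm
      obtain ⟨u', -, hid, hum⟩ := h₀ w _ hwm
      rw [hinj hid, hu0] at hum
      cases hum

/-! ### The run of the algorithm -/

namespace Network

variable {V : Type*} [Fintype V] {c : ℕ} (N : Network V c)

/-- The state of a node in the run of the matching algorithm. -/
noncomputable def st (t : ℕ) (v : V) : NodeState := (matchingAlgorithm c).state N t v

/-- The messages that a node receives in a round of the matching algorithm. -/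
noncomputable def inbox (t : ℕ) (v : V) : List NodeState := (N.nbrs v).map (N.st t)

theorem n_st (t : ℕ) (v : V) : (N.st t v).n = Fintype.card V := by
  induction t with
  | zero => rfl
  | succ t ih => exact ih

theorem time_st (t : ℕ) (v : V) : (N.st t v).time = t := by
  induction t with
  | zero => rfl
  | succ t ih => exact congrArg (· + 1) ih

theorem ident_st (t : ℕ) (v : V) : (N.st t v).ident = N.ident v := by
  induction t with
  | zero => rfl
  | succ t ih => exact ih

theorem nbrs_st_succ (t : ℕ) (v : V) : (N.st (t + 1) v).nbrs = (N.nbrs v).map N.ident := by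
  have : (N.st (t + 1) v).nbrs = (N.inbox t v).map NodeState.ident := rfl
  simp [this, inbox, Function.comp_def, ident_st]

theorem outs_st_succ (t : ℕ) (v : V) :
    (N.st (t + 1) v).outs = (N.st t v).newOuts (N.inbox t v) := rfl

theorem color_st_succ (t : ℕ) (v : V) : (N.st (t + 1) v).color =
    if peelRounds (Fintype.card V) ≤ t ∧ t < peelRounds (Fintype.card V) + 2 then
      (N.st t v).newColor (N.inbox t v) else (N.st t v).color := by
  have : (N.st (t + 1) v).color =
    if peelRounds (N.st t v).n ≤ (N.st t v).time ∧ (N.st t v).time < peelRounds (N.st t v).n + 2 then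
      (N.st t v).newColor (N.inbox t v) else (N.st t v).color := rfl
  rw [this, n_st, time_st]

theorem mate_st_succ (t : ℕ) (v : V) : (N.st (t + 1) v).mate =
    if peelRounds (Fintype.card V) + 2 ≤ t then
      (N.st t v).newMate (N.inbox t v) (numColors c (Fintype.card V))
        (t - (peelRounds (Fintype.card V) + 2))
    else (N.st t v).mate := by
  have : (N.st (t + 1) v).mate =
    if peelRounds (N.st t v).n + 2 ≤ (N.st t v).time then
      (N.st t v).newMate (N.inbox t v) (numColors c (N.st t v).n)
        ((N.st t v).time - (peelRounds (N.st t v).n + 2))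
    else (N.st t v).mate := rfl
  rw [this, n_st, time_st]

theorem mem_inbox {t : ℕ} {v : V} {m : NodeState} :
    m ∈ N.inbox t v ↔ ∃ u, N.graph.Adj v u ∧ N.st t u = m := by
  simp [inbox, mem_nbrs]

/-! ### Orientation -/

theorem length_filter_inbox [DecidableEq V] [DecidableRel N.graph.Adj] (t : ℕ) (v : V) :
    ((N.inbox t v).filter fun m => m.outs.isNone).length
      = (N.graph.neighborFinset v ∩
          Finset.univ.filter fun u => (N.st t u).outs = none).card := by
  rw [inbox, List.filter_map, List.length_map,
    ← List.toFinset_card_of_nodup ((N.nbrs_nodup v).filter _)]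
  congr 1
  ext u
  simp [mem_nbrs]

theorem outs_st_succ_eq_none [DecidableEq V] [DecidableRel N.graph.Adj] (t : ℕ) (v : V) :
    (N.st (t + 1) v).outs = none ↔ (N.st t v).outs = none ∧ outBound (Fintype.card V) <
      (N.graph.neighborFinset v ∩
          Finset.univ.filter fun u => (N.st t u).outs = none).card := by
  rw [← length_filter_inbox, outs_st_succ, NodeState.newOuts, n_st]
  split <;> simp_all

/-- A node surviving a round has more than `2 * shrink` neighbors among the remaining nodes, so the
forest bound leaves at most a fraction `2 / (2 * shrink + 1) < 1 / shrink` of them. -/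
theorem card_outs_eq_none (hG : N.graph.IsAcyclic) (t : ℕ) :
    shrink (Fintype.card V) ^ t * (Finset.univ.filter fun u => (N.st t u).outs = none).card
      ≤ Fintype.card V := by
  classical
  induction t with
  | zero => simpa using Finset.card_le_univ _
  | succ t ih =>
    refine le_trans ?_ ih
    rw [pow_succ, mul_assoc]
    refine Nat.mul_le_mul_left _ ?_
    have h := hG.card_filter_lt_card_inter (Finset.univ.filter fun u => (N.st t u).outs = none)
      (outBound (Fintype.card V))
    rw [Finset.filter_filter] at h
    simp_rw [← N.outs_st_succ_eq_none t] at h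
    unfold outBound at h
    generalize (Finset.univ.filter fun u => (N.st (t + 1) u).outs = none).card = a at *
    generalize (Finset.univ.filter fun u => (N.st t u).outs = none).card = b at *
    nlinarith

theorem outs_st_peelRounds_ne_none (hG : N.graph.IsAcyclic) (v : V) :
    (N.st (peelRounds (Fintype.card V)) v).outs ≠ none := by
  intro h
  have h1 := N.card_outs_eq_none hG (peelRounds (Fintype.card V))
  have h2 := lt_shrink_pow_peelRounds (Fintype.card V)
  have h3 : 0 < (Finset.univ.filter fun u =>
      (N.st (peelRounds (Fintype.card V)) u).outs = none).card :=
    Finset.card_pos.2 ⟨v, by simpa using h⟩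
  nlinarith

theorem outs_st_mono {t : ℕ} {v : V} {l : List ℕ} (h : (N.st t v).outs = some l) {t' : ℕ}
    (ht : t ≤ t') : (N.st t' v).outs = some l := by
  induction t', ht using Nat.le_induction with
  | base => exact h
  | succ t' _ ih => simp [outs_st_succ, NodeState.newOuts, ih]

theorem outs_st_spec {t : ℕ} {v : V} {l : List ℕ} (h : (N.st t v).outs = some l) :
    l.length ≤ outBound (Fintype.card V) ∧ ∀ x ∈ l, ∃ u, N.graph.Adj v u ∧ N.ident u = x := by
  induction t with
  | zero => cases h
  | succ t ih =>
    rw [outs_st_succ, NodeState.newOuts, n_st] at h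
    split at h
    · rename_i l' hl'
      cases h
      exact ih hl'
    · split at h
      · rename_i hlen
        cases h
        refine ⟨by simpa using hlen, fun x hx => ?_⟩
        obtain ⟨m, hm, rfl⟩ := List.mem_map.1 hx
        obtain ⟨u, hu, rfl⟩ := N.mem_inbox.1 (List.mem_filter.1 hm).1
        exact ⟨u, hu, (N.ident_st t u).symm⟩
      · cases h

theorem ident_mem_outs_st_succ {t : ℕ} {v u : V} (huv : N.graph.Adj v u)
    (hv : (N.st t v).outs = none) (hu : (N.st t u).outs = none) {l : List ℕ}
    (h : (N.st (t + 1) v).outs = some l) : N.ident u ∈ l := by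
  rw [outs_st_succ, NodeState.newOuts, hv] at h
  simp only at h
  split at h
  · cases h
    exact List.mem_map.2 ⟨N.st t u, List.mem_filter.2 ⟨N.mem_inbox.2 ⟨u, huv, rfl⟩, by simp [hu]⟩,
      N.ident_st t u⟩
  · cases h

/-- The endpoint peeled first still sees the other as remaining and therefore lists it. -/
theorem edge_oriented (t : ℕ) {v u : V} (huv : N.graph.Adj v u) :
    ((N.st t v).outs = none ∧ (N.st t u).outs = none) ∨
      (∃ l, (N.st t v).outs = some l ∧ N.ident u ∈ l) ∨
      ∃ l, (N.st t u).outs = some l ∧ N.ident v ∈ l := by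
  induction t with
  | zero => exact Or.inl ⟨rfl, rfl⟩
  | succ t ih =>
    rcases ih with ⟨hv, hu⟩ | ⟨l, hl, hm⟩ | ⟨l, hl, hm⟩
    · cases hv' : (N.st (t + 1) v).outs with
      | some l => exact Or.inr (Or.inl ⟨l, rfl, N.ident_mem_outs_st_succ huv hv hu hv'⟩)
      | none =>
        cases hu' : (N.st (t + 1) u).outs with
        | some l => exact Or.inr (Or.inr ⟨l, rfl, N.ident_mem_outs_st_succ huv.symm hu hv hu'⟩)
        | none => exact Or.inl ⟨rfl, rfl⟩
    · exact Or.inr (Or.inl ⟨l, N.outs_st_mono hl t.le_succ, hm⟩)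
    · exact Or.inr (Or.inr ⟨l, N.outs_st_mono hl t.le_succ, hm⟩)

/-- The identifier of the `i`-th out-neighbor of a node in the final orientation. -/
noncomputable def parent (i : ℕ) (v : V) : Option ℕ :=
  (N.st (peelRounds (Fintype.card V)) v).parent i

theorem parent_st (hG : N.graph.IsAcyclic) {t : ℕ} (ht : peelRounds (Fintype.card V) ≤ t)
    (i : ℕ) (v : V) : (N.st t v).parent i = N.parent i v := by
  obtain ⟨l, hl⟩ := Option.ne_none_iff_exists'.1 (N.outs_st_peelRounds_ne_none hG v)
  simp [parent, NodeState.parent, hl, N.outs_st_mono hl ht]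

theorem exists_adj_of_parent_eq_some {i x : ℕ} {v : V} (h : N.parent i v = some x) :
    ∃ u, N.graph.Adj v u ∧ N.ident u = x := by
  obtain ⟨l, hl, hx⟩ := Option.bind_eq_some_iff.1 h
  exact (N.outs_st_spec hl).2 x (List.mem_of_getElem? hx)

theorem exists_parent_eq_some (hG : N.graph.IsAcyclic) {v u : V} (huv : N.graph.Adj v u) :
    ∃ i < outBound (Fintype.card V), N.parent i v = some (N.ident u) ∨
      N.parent i u = some (N.ident v) := by
  have key : ∀ (v : V) (x : ℕ) (l : List ℕ),
      (N.st (peelRounds (Fintype.card V)) v).outs = some l → x ∈ l →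
      ∃ i < outBound (Fintype.card V), N.parent i v = some x := by
    intro v x l hl hx
    obtain ⟨i, hi, hix⟩ := List.mem_iff_getElem.1 hx
    refine ⟨i, hi.trans_le (N.outs_st_spec hl).1, ?_⟩
    simp [parent, NodeState.parent, hl, hi, hix]
  rcases N.edge_oriented (peelRounds (Fintype.card V)) huv with h | ⟨l, hl, hm⟩ | ⟨l, hl, hm⟩
  · exact absurd h.1 (N.outs_st_peelRounds_ne_none hG v)
  · obtain ⟨i, hi, h⟩ := key v _ l hl hm
    exact ⟨i, hi, Or.inl h⟩
  · obtain ⟨i, hi, h⟩ := key u _ l hl hm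
    exact ⟨i, hi, Or.inr h⟩

/-! ### Coloring -/

/-- In each functional graph, the nodes are properly colored with `B` colors. -/
def IsColored (B t : ℕ) : Prop :=
  ∀ i v, (N.st t v).color i < B ∧ ∀ u, N.graph.Adj v u → N.parent i v = some (N.ident u) →
    (N.st t v).color i ≠ (N.st t u).color i

theorem find_parent (hG : N.graph.IsAcyclic) {t : ℕ} (ht : peelRounds (Fintype.card V) ≤ t)
    {i : ℕ} {v u : V} (huv : N.graph.Adj v u) (h : N.parent i v = some (N.ident u)) :
    ((N.inbox t v).find? fun m => (N.st t v).parent i == some m.ident) = some (N.st t u) := by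
  rw [N.parent_st hG ht, h]
  cases hf : (N.inbox t v).find? fun m => some (N.ident u) == some m.ident with
  | none =>
    have := List.find?_eq_none.1 hf _ (N.mem_inbox.2 ⟨u, huv, rfl⟩)
    simp [ident_st] at this
  | some m =>
    obtain ⟨w, -, rfl⟩ := N.mem_inbox.1 (List.mem_of_find?_eq_some hf)
    have := List.find?_some hf
    simp only [ident_st, beq_iff_eq, Option.some.injEq] at this
    rw [N.ident_injective this]

theorem find_parent_of_eq_none (hG : N.graph.IsAcyclic) {t : ℕ}
    (ht : peelRounds (Fintype.card V) ≤ t) {i : ℕ} {v : V} (h : N.parent i v = none) :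
    ((N.inbox t v).find? fun m => (N.st t v).parent i == some m.ident) = none := by
  simp [N.parent_st hG ht, h]

theorem IsColored.succ {N : Network V c} (hG : N.graph.IsAcyclic) {t m : ℕ} (hm : 0 < m)
    (ht : peelRounds (Fintype.card V) ≤ t) (ht' : t < peelRounds (Fintype.card V) + 2)
    (h : N.IsColored (2 ^ m) t) : N.IsColored (2 * m) (t + 1) := by
  intro i v
  rw [color_st_succ, if_pos ⟨ht, ht'⟩]
  refine ⟨?_, fun u huv hu => ?_⟩
  · rw [NodeState.newColor]
    cases hp : N.parent i v with
    | none =>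
      rw [N.find_parent_of_eq_none hG ht hp]
      exact reduceColor_lt hm (by simp) (h i v).1 (by simp)
    | some x =>
      obtain ⟨u, huv, rfl⟩ := N.exists_adj_of_parent_eq_some hp
      rw [N.find_parent hG ht huv hp]
      refine reduceColor_lt hm ?_ (h i v).1 ?_
      · simpa using ((h i v).2 u huv hp).symm
      · simpa using (h i u).1
  · rw [color_st_succ, if_pos ⟨ht, ht'⟩, NodeState.newColor, N.find_parent hG ht huv hu]
    -- `v` compares with the color of `u`; what `u` compares with is irrelevant.
    exact coleVishkin_ne ((h i v).2 u huv hu)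

theorem color_st_of_le {t : ℕ} (ht : t ≤ peelRounds (Fintype.card V)) (v : V) (i : ℕ) :
    (N.st t v).color i = N.ident v := by
  induction t with
  | zero => rfl
  | succ t ih =>
    rw [color_st_succ, if_neg (by omega)]
    exact ih (by omega)

theorem isColored (hG : N.graph.IsAcyclic) {t : ℕ} (ht : peelRounds (Fintype.card V) + 2 ≤ t) :
    N.IsColored (numColors c (Fintype.card V)) t := by
  induction t, ht using Nat.le_induction with
  | base =>
    have h0 : N.IsColored (2 ^ identBits c (Fintype.card V)) (peelRounds (Fintype.card V)) := by
      intro i v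
      simp only [N.color_st_of_le le_rfl]
      exact ⟨(N.ident_le v).trans_lt (pow_lt_two_pow_identBits _ _),
        fun u huv _ h => huv.ne (N.ident_injective h)⟩
    have h1 := h0.succ hG (by unfold identBits; omega) le_rfl (by omega)
    -- The first step leaves `2 * identBits` colors; the second acts on their binary expansions.
    refine IsColored.succ hG (by omega) (by omega) (by omega) fun i v => ⟨?_, (h1 i v).2⟩
    exact (h1 i v).1.trans (Nat.lt_pow_succ_log_self (by norm_num) _)
  | succ t ht ih =>
    intro i v
    simp only [color_st_succ, if_neg (show ¬(peelRounds (Fintype.card V) ≤ t ∧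
      t < peelRounds (Fintype.card V) + 2) by omega)]
    exact ih i v

theorem color_st_succ_of_le {t : ℕ} (ht : peelRounds (Fintype.card V) + 2 ≤ t) (v : V) :
    (N.st (t + 1) v).color = (N.st t v).color := by
  rw [color_st_succ, if_neg (by omega)]

theorem color_st_add (v : V) (s : ℕ) : (N.st (peelRounds (Fintype.card V) + 2 + s) v).color =
    (N.st (peelRounds (Fintype.card V) + 2) v).color := by
  induction s with
  | zero => rfl
  | succ s ih => rw [← add_assoc, color_st_succ_of_le _ (by omega), ih]

/-! ### Matching -/

theorem propose_of_not {t i k : ℕ} {v : V}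
    (h : ¬((N.st t v).mate = none ∧ (N.st t v).color i = k)) :
    (N.st t v).propose (N.inbox t v) i k = (N.st t v).mate := if_neg h

theorem exists_of_propose_eq_some (hG : N.graph.IsAcyclic) {t i k x : ℕ} {v : V}
    (ht : peelRounds (Fintype.card V) ≤ t)
    (h1 : (N.st t v).mate = none) (h2 : (N.st t v).color i = k)
    (h : (N.st t v).propose (N.inbox t v) i k = some x) :
    ∃ u, N.graph.Adj v u ∧ N.ident u = x ∧ (N.st t u).mate = none ∧
      N.parent i u = some (N.ident v) := by
  rw [NodeState.propose, if_pos ⟨h1, h2⟩] at h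
  obtain ⟨m, hm, rfl⟩ := Option.map_eq_some_iff.1 h
  obtain ⟨u, huv, rfl⟩ := N.mem_inbox.1 (List.mem_of_find?_eq_some hm)
  have := List.find?_some hm
  simp only [ident_st, N.parent_st hG ht, Bool.and_eq_true, Option.isNone_iff_eq_none,
    beq_iff_eq] at this
  exact ⟨u, huv, (N.ident_st t u).symm, this⟩

/-- A matched `v` keeps its mate; an unmatched one finds a candidate, since `u` is one. -/
theorem propose_ne_none (hG : N.graph.IsAcyclic) {t i : ℕ} {v u : V}
    (ht : peelRounds (Fintype.card V) ≤ t) (huv : N.graph.Adj v u)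
    (hu : (N.st t u).mate = none) (hp : N.parent i u = some (N.ident v)) :
    (N.st t v).propose (N.inbox t v) i ((N.st t v).color i) ≠ none := by
  rw [NodeState.propose]
  split
  · intro h
    have := List.find?_eq_none.1 (Option.map_eq_none_iff.1 h) _ (N.mem_inbox.2 ⟨u, huv, rfl⟩)
    simp [ident_st, N.parent_st hG ht, hu, hp] at this
  · simp_all

theorem accept_of_ne_none {t : ℕ} {v : V} (h : (N.st t v).mate ≠ none) :
    (N.st t v).accept (N.inbox t v) = (N.st t v).mate := if_neg h

theorem exists_of_accept_eq_some {t x : ℕ} {v : V} (h1 : (N.st t v).mate = none)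
    (h : (N.st t v).accept (N.inbox t v) = some x) :
    ∃ u, N.graph.Adj v u ∧ N.ident u = x ∧ (N.st t u).mate = some (N.ident v) := by
  rw [NodeState.accept, if_pos h1] at h
  obtain ⟨m, hm, rfl⟩ := Option.map_eq_some_iff.1 h
  obtain ⟨u, huv, rfl⟩ := N.mem_inbox.1 (List.mem_of_find?_eq_some hm)
  have := List.find?_some hm
  simp only [ident_st, beq_iff_eq] at this
  exact ⟨u, huv, (N.ident_st t u).symm, this⟩

theorem mate_ne_of_accept_eq_none {t : ℕ} {v u : V} (h1 : (N.st t v).mate = none)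
    (h : (N.st t v).accept (N.inbox t v) = none) (huv : N.graph.Adj v u) :
    (N.st t u).mate ≠ some (N.ident v) := by
  rw [NodeState.accept, if_pos h1] at h
  have := List.find?_eq_none.1 (Option.map_eq_none_iff.1 h) _ (N.mem_inbox.2 ⟨u, huv, rfl⟩)
  simpa [ident_st] using this

theorem mate_st_propose (j : ℕ) (v : V) :
    (N.st (peelRounds (Fintype.card V) + 2 + 2 * j + 1) v).mate =
      (N.st (peelRounds (Fintype.card V) + 2 + 2 * j) v).propose
        (N.inbox (peelRounds (Fintype.card V) + 2 + 2 * j) v)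
        (j / numColors c (Fintype.card V)) (j % numColors c (Fintype.card V)) := by
  rw [mate_st_succ, if_pos (by omega), NodeState.newMate, Nat.add_sub_cancel_left,
    if_pos (by omega), Nat.mul_div_cancel_left _ (by norm_num)]

theorem mate_st_accept (j : ℕ) (v : V) :
    (N.st (peelRounds (Fintype.card V) + 2 + 2 * (j + 1)) v).mate =
      (N.st (peelRounds (Fintype.card V) + 2 + 2 * j + 1) v).accept
        (N.inbox (peelRounds (Fintype.card V) + 2 + 2 * j + 1) v) := by
  rw [mul_add, mul_one, ← add_assoc, mate_st_succ, if_pos (by omega), NodeState.newMate,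
    if_neg (by omega)]

/-- The invariant is stated only after complete proposal–acceptance pairs, because a pending
proposal is one-sided. -/
theorem isMutual_st (hG : N.graph.IsAcyclic) (j : ℕ) :
    IsMutual N.graph N.ident
      fun v => (N.st (peelRounds (Fintype.card V) + 2 + 2 * j) v).mate := by
  induction j with
  | zero =>
    have : ∀ t ≤ peelRounds (Fintype.card V) + 2, ∀ v, (N.st t v).mate = none := by
      intro t ht v
      induction t with
      | zero => rfl
      | succ t ih =>
        rw [mate_st_succ, if_neg (by omega)]
        exact ih (by omega)
    intro v x hx
    simp [this _ (le_refl _)] at hx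
  | succ j ih =>
    refine IsMutual.propose_accept
      (m₁ := fun v => (N.st (peelRounds (Fintype.card V) + 2 + 2 * j + 1) v).mate)
      (p := N.parent (j / numColors c (Fintype.card V)))
      (col := fun v => (N.st (peelRounds (Fintype.card V) + 2 + 2 * j) v).color
        (j / numColors c (Fintype.card V)))
      (k := j % numColors c (Fintype.card V)) N.ident_injective
      (fun v u huv hu => (N.isColored hG (by omega) _ v).2 u huv hu) ih ?_ ?_ ?_ ?_ ?_
    · intro v hv
      simp only [mate_st_propose]
      exact N.propose_of_not hv
    · intro v hv hc x hx
      simp only [mate_st_propose] at hx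
      exact N.exists_of_propose_eq_some hG (by omega) hv hc hx
    · intro v hv
      simp only [mate_st_accept]
      exact N.accept_of_ne_none hv
    · intro v hv x hx
      simp only [mate_st_accept] at hx
      exact N.exists_of_accept_eq_some hv hx
    · intro v hv hv2 u huv
      simp only [mate_st_accept] at hv2
      exact N.mate_ne_of_accept_eq_none hv hv2 huv

theorem mate_st_succ_ne_none {t : ℕ} {v : V} (h : (N.st t v).mate ≠ none) :
    (N.st (t + 1) v).mate ≠ none := by
  rw [mate_st_succ]
  split
  · rw [NodeState.newMate]
    split
    · rwa [N.propose_of_not (by tauto)]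
    · rwa [N.accept_of_ne_none h]
  · exact h

theorem mate_st_ne_none_mono {t t' : ℕ} (ht : t ≤ t') {v : V} (h : (N.st t v).mate ≠ none) :
    (N.st t' v).mate ≠ none := by
  induction t', ht using Nat.le_induction with
  | base => exact h
  | succ t' _ ih => exact N.mate_st_succ_ne_none ih

theorem mate_ne_none_of_adj (hG : N.graph.IsAcyclic) {v u : V} (huv : N.graph.Adj v u) :
    (N.st (totalRounds c (Fintype.card V)) v).mate ≠ none ∨
      (N.st (totalRounds c (Fintype.card V)) u).mate ≠ none := by
  have key : ∀ {v u : V}, N.graph.Adj v u → ∀ i < outBound (Fintype.card V),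
      N.parent i u = some (N.ident v) →
      (N.st (totalRounds c (Fintype.card V)) v).mate ≠ none ∨
        (N.st (totalRounds c (Fintype.card V)) u).mate ≠ none := by
    intro v u huv i hi hp
    have hk := (N.isColored hG le_rfl i v).1
    set C := numColors c (Fintype.card V) with hC
    set k := (N.st (peelRounds (Fintype.card V) + 2) v).color i with hkdef
    -- The pair of rounds numbered `j` serves graph `i` and color `k`, the color of the parent `v`.
    set j := i * C + k with hj
    have hC0 : 0 < C := by omega
    have hji : j / C = i := by
      rw [hj, mul_comm, Nat.mul_add_div hC0, Nat.div_eq_of_lt hk, add_zero]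
    have hjk : j % C = k := by
      rw [hj, mul_comm, Nat.mul_add_mod, Nat.mod_eq_of_lt hk]
    have hjlt : j + 1 ≤ outBound (Fintype.card V) * C := by
      calc j + 1 ≤ (i + 1) * C := by rw [hj, add_mul]; omega
        _ ≤ _ := Nat.mul_le_mul_right _ hi
    have hT : peelRounds (Fintype.card V) + 2 + 2 * j + 1 ≤ totalRounds c (Fintype.card V) := by
      rw [totalRounds, ← hC]
      omega
    -- Either the child is matched by then, or it is available and the parent leaves the proposal
    -- step matched. Matched nodes stay matched.
    by_cases hu : (N.st (peelRounds (Fintype.card V) + 2 + 2 * j) u).mate = none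
    · left
      refine N.mate_st_ne_none_mono hT ?_
      rw [mate_st_propose, ← hC, hji, hjk, hkdef, ← N.color_st_add v (2 * j)]
      exact N.propose_ne_none hG (by omega) huv hu hp
    · right
      exact N.mate_st_ne_none_mono (by omega) hu
  obtain ⟨i, hi, h | h⟩ := N.exists_parent_eq_some hG huv
  · exact (key huv.symm i hi h).symm
  · exact key huv i hi h

theorem halfEdgeOutput_eq_true {t : ℕ} {v u : V} (huv : N.graph.Adj v u) :
    (matchingAlgorithm c).halfEdgeOutput N (t + 1) v u = true ↔
      (N.st (t + 1) v).mate = some (N.ident u) := by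
  classical
  have h1 : (matchingAlgorithm c).halfEdgeOutput N (t + 1) v u =
      ((N.st (t + 1) v).mate.isSome &&
        (N.st (t + 1) v).nbrs[N.port v u]? == (N.st (t + 1) v).mate) := rfl
  have h2 : ((N.nbrs v).map N.ident)[N.port v u]? = some (N.ident u) := by
    have hu : u ∈ N.nbrs v := (N.mem_nbrs v u).2 huv
    rw [List.getElem?_map, Network.port, List.getElem?_idxOf hu]
    rfl
  rw [h1, nbrs_st_succ, h2]
  cases (N.st (t + 1) v).mate <;> simp [@eq_comm _ (N.ident u)]

end Network

/-! ### Correctness -/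

/-- A mutual choice of mates that leaves no edge with both endpoints unmatched is a maximal
matching. -/
theorem IsMutual.exists_isMaximalMatching {V : Type*} {G : SimpleGraph V} {ident : V → ℕ}
    (hinj : Function.Injective ident) {m : V → Option ℕ} (h : IsMutual G ident m)
    (hmax : ∀ v u, G.Adj v u → m v ≠ none ∨ m u ≠ none) :
    ∃ M : G.Subgraph, IsMaximalMatching M ∧
      ∀ v u, G.Adj v u → (m v = some (ident u) ↔ M.Adj v u) := by
  let M : G.Subgraph :=
    { verts := {v | m v ≠ none}
      Adj := fun v u => G.Adj v u ∧ m v = some (ident u)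
      adj_sub := fun h => h.1
      edge_vert := fun {v w} h => by simp [h.2]
      symm := ⟨fun v u hvu => by
        obtain ⟨w, -, hid, hw⟩ := h v _ hvu.2
        rw [hinj hid] at hw
        exact ⟨hvu.1.symm, hw⟩⟩ }
  have hex : ∀ v, m v ≠ none → ∃ w, M.Adj v w := by
    intro v hv
    obtain ⟨x, hx⟩ := Option.ne_none_iff_exists'.1 hv
    obtain ⟨u, hu, rfl, -⟩ := h v x hx
    exact ⟨u, hu, hx⟩
  refine ⟨M, ⟨fun v hv => ?_, fun M' hM' hle => ?_⟩, fun v u huv => ⟨fun h => ⟨huv, h⟩, And.right⟩⟩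
  · obtain ⟨w, hw⟩ := hex v hv
    refine ⟨w, hw, fun u hu => hinj (Option.some_injective _ (hu.2.symm.trans hw.2))⟩
  -- A vertex matched in `M` keeps its partner in the larger matching `M'`, where partners are
  -- unique.
  · have key : ∀ v w, M'.Adj v w → m v ≠ none → M.Adj v w := by
      intro v w hvw hv
      obtain ⟨w', hw'⟩ := hex v hv
      rwa [(hM' (M'.edge_vert hvw)).unique hvw (hle.2 hw')]
    have hadj : ∀ v w, M'.Adj v w → M.Adj v w := by
      intro v w hvw
      rcases hmax v w hvw.adj_sub with hv | hw
      · exact key v w hvw hv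
      · exact (key w v hvw.symm hw).symm
    refine ⟨fun v hv => ?_, fun v w => hadj v w⟩
    obtain ⟨w, hw, -⟩ := hM' hv
    exact M.edge_vert (hadj v w hw)

theorem computesMaximalMatching_matchingAlgorithm {V : Type*} [Fintype V] {c : ℕ}
    (N : Network V c) (hG : N.graph.IsAcyclic) :
    (matchingAlgorithm c).ComputesMaximalMatching N (totalRounds c (Fintype.card V)) := by
  obtain ⟨M, hM, hM'⟩ := (N.isMutual_st hG
    (outBound (Fintype.card V) * numColors c (Fintype.card V))).exists_isMaximalMatching
    N.ident_injective fun v u huv => N.mate_ne_none_of_adj hG huv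
  refine ⟨M, hM, fun v u huv => ?_⟩
  rw [← hM' v u huv]
  obtain ⟨t, ht⟩ : ∃ t, totalRounds c (Fintype.card V) = t + 1 :=
    ⟨totalRounds c (Fintype.card V) - 1, by unfold totalRounds; omega⟩
  rw [show peelRounds (Fintype.card V) + 2 + 2 * (outBound (Fintype.card V) *
    numColors c (Fintype.card V)) = t + 1 from ht, ht]
  exact N.halfEdgeOutput_eq_true huv

/-! ### The number of rounds -/

open Asymptotics

theorem natLog_two_isBigO :
    (fun n : ℕ => (Nat.log 2 n : ℝ)) =O[atTop] fun n : ℕ => Real.log n := by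
  refine IsBigO.of_bound (Real.log 2)⁻¹ (Eventually.of_forall fun n => ?_)
  rw [Real.norm_of_nonneg (by positivity), Real.norm_of_nonneg (Real.log_natCast_nonneg n)]
  refine (Real.natLog_le_logb n 2).trans_eq ?_
  rw [Real.logb, div_eq_inv_mul]
  norm_cast

theorem tendsto_log_natCast : Tendsto (fun n : ℕ => Real.log n) atTop atTop :=
  Real.tendsto_log_atTop.comp tendsto_natCast_atTop_atTop

theorem const_isBigO_log (a : ℝ) : (fun _ : ℕ => a) =O[atTop] fun n : ℕ => Real.log n :=
  (isLittleO_const_left.2 (Or.inr (tendsto_norm_atTop_atTop.comp tendsto_log_natCast))).isBigO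

theorem const_isBigO_log_rpow (a : ℝ) {e : ℝ} (he : 0 < e) :
    (fun _ : ℕ => a) =O[atTop] fun n : ℕ => Real.log n ^ e :=
  (isLittleO_const_left.2 (Or.inr (tendsto_norm_atTop_atTop.comp
    ((tendsto_rpow_atTop he).comp tendsto_log_natCast)))).isBigO

theorem shrink_isBigO :
    (fun n : ℕ => (shrink n : ℝ)) =O[atTop] fun n : ℕ => Real.log n ^ (1 / 2 : ℝ) := by
  have h1 : (fun n : ℕ => (Nat.sqrt (Nat.log 2 n) : ℝ)) =O[atTop]
      fun n : ℕ => Real.log n ^ (1 / 2 : ℝ) := by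
    refine IsBigO.trans (IsBigO.of_bound 1 (Eventually.of_forall fun n => ?_))
      (natLog_two_isBigO.rpow (r := 1 / 2) (by norm_num)
        (Eventually.of_forall fun n => Real.log_natCast_nonneg n))
    rw [← Real.sqrt_eq_rpow, one_mul, Real.norm_of_nonneg (by positivity),
      Real.norm_of_nonneg (by positivity)]
    exact Real.nat_sqrt_le_real_sqrt
  simp only [shrink, Nat.cast_add]
  exact h1.add (const_isBigO_log_rpow _ (by norm_num))

theorem identBits_isBigO (c : ℕ) :
    (fun n : ℕ => (identBits c n : ℝ)) =O[atTop] fun n : ℕ => Real.log n := by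
  simp only [identBits, Nat.cast_add, Nat.cast_mul]
  exact ((natLog_two_isBigO.add (const_isBigO_log _)).const_mul_left _).add (const_isBigO_log _)

/-- The true order is log log n; the exponent 1/4 is a convenient weakening, since with the 1/2 from
`shrink` it gives 3/4 < 1. -/
theorem numColors_isBigO (c : ℕ) :
    (fun n : ℕ => (numColors c n : ℝ)) =O[atTop] fun n : ℕ => Real.log n ^ (1 / 4 : ℝ) := by
  have h1 : (fun n : ℕ => (Nat.log 2 (2 * identBits c n) : ℝ)) =O[atTop]
      fun n : ℕ => Real.log n ^ (1 / 4 : ℝ) := by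
    refine IsBigO.trans (IsBigO.of_bound (4 / Real.log 2) (Eventually.of_forall fun n => ?_))
      (((identBits_isBigO c).const_mul_left 2).rpow (r := 1 / 4) (by norm_num)
        (Eventually.of_forall fun n => Real.log_natCast_nonneg n))
    rw [Real.norm_of_nonneg (by positivity), Real.norm_of_nonneg (by positivity)]
    refine (Real.natLog_le_logb _ 2).trans ?_
    have h2 : Real.log (2 * identBits c n) ≤ (2 * identBits c n) ^ (1 / 4 : ℝ) / (1 / 4) :=
      Real.log_le_rpow_div (by positivity) (by norm_num)
    have h3 : 0 < Real.log 2 := Real.log_pos (by norm_num)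
    rw [Real.logb]
    push_cast
    rw [div_mul_eq_mul_div]
    gcongr
    linarith
  simp only [numColors, Nat.cast_add, Nat.cast_mul]
  exact (h1.add (const_isBigO_log_rpow _ (by norm_num))).const_mul_left _

theorem log_rpow_isBigO : (fun n : ℕ => Real.log n ^ (3 / 4 : ℝ)) =O[atTop]
    fun n : ℕ => Real.log n / Real.log (Real.log n) := by
  refine IsBigO.of_bound 4 ?_
  filter_upwards [tendsto_log_natCast.eventually_gt_atTop 1] with n hn
  have h1 : 0 < Real.log (Real.log n) := Real.log_pos hn
  rw [Real.norm_of_nonneg (by positivity), Real.norm_of_nonneg (by positivity), ← mul_div_assoc,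
    le_div_iff₀ h1]
  have h2 : Real.log (Real.log n) ≤ Real.log n ^ (1 / 4 : ℝ) / (1 / 4) :=
    Real.log_le_rpow_div (by positivity) (by norm_num)
  calc Real.log n ^ (3 / 4 : ℝ) * Real.log (Real.log n)
      ≤ Real.log n ^ (3 / 4 : ℝ) * (Real.log n ^ (1 / 4 : ℝ) / (1 / 4)) := by gcongr
    _ = 4 * (Real.log n ^ (3 / 4 : ℝ) * Real.log n ^ (1 / 4 : ℝ)) := by ring
    _ = 4 * Real.log n := by
        rw [← Real.rpow_add (by positivity)]
        norm_num

theorem natLog_shrink_isBigO : (fun n : ℕ => (Nat.log (shrink n) n : ℝ)) =O[atTop]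
    fun n : ℕ => Real.log n / Real.log (Real.log n) := by
  refine IsBigO.of_bound 2 ?_
  filter_upwards [tendsto_log_natCast.eventually_gt_atTop 1] with n hn
  have h1 : 0 < Real.log (Real.log n) := Real.log_pos hn
  rw [Real.norm_of_nonneg (by positivity), Real.norm_of_nonneg (by positivity)]
  refine (Real.natLog_le_logb _ _).trans ?_
  -- From `log n ≤ shrink n ^ 2` it follows that `log (shrink n)` is at least half of `log (log n)`,
  -- whence the constant 2.
  have hn0 : 0 < n := Nat.pos_of_ne_zero fun h => by simp [h] at hn; linarith
  have h2 : Real.log n ≤ (shrink n : ℝ) ^ 2 := by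
    have h3 : n < 2 ^ (Nat.log 2 n + 1) := Nat.lt_pow_succ_log_self (by norm_num) n
    have h4 : Nat.log 2 n + 1 ≤ shrink n ^ 2 := by
      have := Nat.lt_succ_sqrt (Nat.log 2 n)
      unfold shrink
      simp only [Nat.succ_eq_add_one] at this
      nlinarith
    calc Real.log n ≤ Real.log ((2 : ℝ) ^ (Nat.log 2 n + 1)) :=
          Real.log_le_log (by positivity) (by exact_mod_cast h3.le)
      _ = (Nat.log 2 n + 1 : ℕ) * Real.log 2 := by rw [Real.log_pow]
      _ ≤ (Nat.log 2 n + 1 : ℕ) * 1 := by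
          gcongr
          linarith [Real.log_two_lt_d9]
      _ ≤ (shrink n : ℝ) ^ 2 := by rw [mul_one]; exact_mod_cast h4
  have h5 : Real.log (Real.log n) ≤ 2 * Real.log (shrink n) := by
    calc Real.log (Real.log n) ≤ Real.log ((shrink n : ℝ) ^ 2) :=
          Real.log_le_log (by positivity) h2
      _ = 2 * Real.log (shrink n) := by rw [Real.log_pow]; norm_num
  rw [Real.logb, ← mul_div_assoc, div_le_div_iff₀ (by linarith) h1]
  nlinarith

theorem totalRounds_isBigO (c : ℕ) : (fun n : ℕ => (totalRounds c n : ℝ)) =O[atTop]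
    fun n : ℕ => Real.log n / Real.log (Real.log n) := by
  have hconst : ∀ a : ℝ, (fun _ : ℕ => a) =O[atTop]
      fun n : ℕ => Real.log n / Real.log (Real.log n) := fun a =>
    (const_isBigO_log_rpow a (by norm_num)).trans log_rpow_isBigO
  have h1 : (fun n : ℕ => (shrink n : ℝ) * numColors c n) =O[atTop]
      fun n : ℕ => Real.log n / Real.log (Real.log n) := by
    refine ((shrink_isBigO.mul (numColors_isBigO c)).trans_eventuallyEq ?_).trans log_rpow_isBigO
    filter_upwards [tendsto_log_natCast.eventually_gt_atTop 1] with n hn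
    rw [← Real.rpow_add (by linarith)]
    norm_num
  -- The 3 is the extra peeling round plus two coloring rounds; the 4 is two rounds per proposal
  -- times the factor 2 in `outBound`.
  refine ((natLog_shrink_isBigO.add (hconst 3)).add (h1.const_mul_left 4)).congr_left fun n => ?_
  simp only [totalRounds, peelRounds, outBound]
  push_cast
  ring

end LocalModel

theorem mainTheorem4 (c : ℕ) :
    ∃ (A : LocalModel.Algorithm Bool) (T : ℕ → ℕ),
      (fun n : ℕ => (T n : ℝ)) =O[Filter.atTop]
        (fun n : ℕ => Real.log (n : ℝ) / Real.log (Real.log (n : ℝ))) ∧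
      ∀ (V : Type*) [Fintype V] (N : LocalModel.Network V c), N.graph.IsTree →
        A.ComputesMaximalMatching N (T (Fintype.card V)) :=
  ⟨LocalModel.matchingAlgorithm c, LocalModel.totalRounds c, LocalModel.totalRounds_isBigO c,
    fun _ _ N hG => LocalModel.computesMaximalMatching_matchingAlgorithm N hG.isAcyclic⟩
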